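/- Let $n\ge 3$ and $k\ge 2$, and let $|E_k\rangle=\sum_{i_1+\dots+i_n=k}|i_1 i_2\dots i_n\rangle\in(\mathbb C^{k+1})^{\otimes n}$, where $i_1,\dots,i_n\in\{0,\dots,k\}$. States are nonzero vectors of $(\mathbb C^{k+1})^{\otimes n}$, considered up to nonzero scalar factors. The SLOCC class of $|E_k\rangle$ is the set of all states $A_1\otimes\dots\otimes A_n|E_k\rangle$ with $A_1,\dots,A_n\in GL(k+1,\mathbb C)$. A state is fully entangled if all its single-party reduced density matrices have full rank. Two states are LU-equivalent if a local unitary $U_1\otimes\dots\otimes U_n$ maps one to a nonzero multiple of the other. A fully entangled state $|\Phi\rangle$ is called weakly isolated if both of the following hold. (1) It is not $LOCC_{\mathbb N}$-reachable: there is no state that is LU-inequivalent to $|\Phi\rangle$ and can be transformed deterministically into $|\Phi\rangle$ by an LOCC protocol with finitely many rounds. In each round of such a protocol one party, chosen depending on the previous outcomes, performs a generalized measurement $\{A_a\}$ with finitely many measurement operators, $\sum_a A_a^\dagger A_a=\mathbb 1$, and communicates the outcome to the other parties. Deterministic means that every branch of nonzero probability ends in a nonzero multiple of $|\Phi\rangle$.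 (2) It is not $LOCC_1$-convertible: it cannot be transformed deterministically into a fully entangled state that is LU-inequivalent to it by a protocol in which one party performs a single such measurement and the parties then apply local unitaries depending on the outcome. Then the SLOCC class of $|E_k\rangle$ contains weakly isolated states. More precisely, for pairwise distinct nonzero $a_1,\dots,a_n\in\mathbb C$ let $g_i$ be the $(k+1)\times(k+1)$ matrix, with rows and columns numbered $0,\dots,k$, that differs from the identity matrix only in its $(k-1,k)$ entry, which is $a_i$. Then the state $g_1\otimes\dots\otimes g_n|E_k\rangle$ is weakly isolated. If $k\ge 3$, then the SLOCC class of $|E_k\rangle$ contains a weakly isolated state that is symmetric, i.e. invariant under all permutations of the $n$ parties. -/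

import Mathlib

namespace LOCC

/-- Unnormalized pure states of `n` parties with local dimension `d`, i.e. vectors of
`(ℂ^d)^{⊗ n}`, given by their amplitudes `⟨m₁ … mₙ|ψ⟩` in the computational basis. -/
abbrev State (n d : ℕ) : Type := (Fin n → Fin d) → ℂ

/-- The state `(A₁ ⊗ … ⊗ Aₙ) |ψ⟩`. -/
noncomputable def localAct {n d : ℕ} (A : Fin n → Matrix (Fin d) (Fin d) ℂ) (ψ : State n d) :
    State n d :=
  fun m => ∑ i : Fin n → Fin d, (∏ j, A j (m j) (i j)) * ψ i

/-- The operator `M` acting on party `i`, with the identity on all other parties. -/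
noncomputable def siteAct {n d : ℕ} (i : Fin n) (M : Matrix (Fin d) (Fin d) ℂ) (ψ : State n d) :
    State n d :=
  localAct (Function.update (fun _ => (1 : Matrix (Fin d) (Fin d) ℂ)) i M) ψ

/-- SLOCC equivalence: `|ψ⟩ = A₁ ⊗ … ⊗ Aₙ |φ⟩` with all `Aᵢ` invertible. -/
def SLOCCEquiv {n d : ℕ} (ψ φ : State n d) : Prop :=
  ∃ A : Fin n → Matrix.GeneralLinearGroup (Fin d) ℂ,
    ψ = localAct (fun j => (A j : Matrix (Fin d) (Fin d) ℂ)) φ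

/-- Local unitary equivalence of unnormalized states: `|ψ⟩ ∝ U₁ ⊗ … ⊗ Uₙ |φ⟩`. -/
def LUEquiv {n d : ℕ} (ψ φ : State n d) : Prop :=
  ∃ (U : Fin n → Matrix.unitaryGroup (Fin d) ℂ) (c : ℂ), c ≠ 0 ∧
    ψ = c • localAct (fun j => (U j : Matrix (Fin d) (Fin d) ℂ)) φ

/-- The (unnormalized) reduced density matrix of party `i`: the partial trace of `|ψ⟩⟨ψ|` over all
other parties. -/
noncomputable def reducedDensity {n d : ℕ} (ψ : State n d) (i : Fin n) :
    Matrix (Fin d) (Fin d) ℂ :=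
  fun a b => ∑ m : Fin n → Fin d,
    if m i = a then ψ m * star (ψ (Function.update m i b)) else 0

/-- All single-party reduced density matrices have full rank. -/
def FullyEntangled {n d : ℕ} (ψ : State n d) : Prop :=
  ∀ i : Fin n, (reducedDensity ψ i).rank = d

/-- The state is invariant under all permutations of the parties. -/
def IsSymmetric {n d : ℕ} (ψ : State n d) : Prop :=
  ∀ (σ : Equiv.Perm (Fin n)) (m : Fin n → Fin d), ψ (m ∘ σ) = ψ m

/-- A deterministic LOCC protocol with finitely many rounds, as a finite tree. In each round one
party performs a generalized measurement with finitely many outcomes and announces the outcome;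
the continuation may depend on it. Local unitaries are rounds with a single outcome. -/
inductive Protocol (n d : ℕ) : Type
  | finish : Protocol n d
  | round (i : Fin n) (r : ℕ) (A : Fin r → Matrix (Fin d) (Fin d) ℂ)
      (complete : ∑ a, (A a).conjTranspose * A a = 1) (next : Fin r → Protocol n d) : Protocol n d

/-- Run on `|ψ⟩`, the protocol ends in the state `|φ⟩`, up to a nonzero scalar, along every
sequence of outcomes that has nonzero probability. -/
def Protocol.Converts {n d : ℕ} : Protocol n d → State n d → State n d → Prop
  | .finish, ψ, φ => ∃ c : ℂ, c ≠ 0 ∧ ψ = c • φ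
  | .round i _ A _ next, ψ, φ =>
      ∀ a, siteAct i (A a) ψ ≠ 0 → (next a).Converts (siteAct i (A a) ψ) φ

/-- `|φ⟩` can be obtained from some state that is not local-unitarily equivalent to it by a
deterministic LOCC protocol with finitely many rounds. -/
def ReachableFiniteRounds {n d : ℕ} (φ : State n d) : Prop :=
  ∃ ψ : State n d, ψ ≠ 0 ∧ ¬ LUEquiv ψ φ ∧ ∃ P : Protocol n d, P.Converts ψ φ

/-- `|ψ⟩` can be converted, in one round, into some fully entangled state `|φ⟩` that is not
local-unitarily equivalent to it: one party performs a generalized measurement, after which all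
parties apply unitaries that may depend on the outcome (the unitary of the measuring party could
be absorbed in its measurement operators). -/
def ConvertibleOneRound {n d : ℕ} (ψ : State n d) : Prop :=
  ∃ φ : State n d, FullyEntangled φ ∧ ¬ LUEquiv ψ φ ∧
    ∃ (i : Fin n) (r : ℕ) (A : Fin r → Matrix (Fin d) (Fin d) ℂ),
      ∑ a, (A a).conjTranspose * A a = 1 ∧
      ∀ a, siteAct i (A a) ψ ≠ 0 → LUEquiv (siteAct i (A a) ψ) φ

/-- Weak isolation: neither reachable by finite-round LOCC nor convertible by one-round LOCC. -/
def WeaklyIsolated {n d : ℕ} (ψ : State n d) : Prop :=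
  ¬ ReachableFiniteRounds ψ ∧ ¬ ConvertibleOneRound ψ

/-- The state `|E_k⟩ = ∑_{i₁ + … + iₙ = k} |i₁ … iₙ⟩` of `n` parties with local dimension
`k + 1`. -/
def excitationState (n k : ℕ) : State n (k + 1) :=
  fun m => if ∑ j, (m j : ℕ) = k then 1 else 0

/-- The `(k + 1) × (k + 1)` matrix that differs from the identity only in the entry `a` in row
`k - 1` and column `k`, where rows and columns are numbered `0, …, k`. -/
def shear (k : ℕ) (a : ℂ) : Matrix (Fin (k + 1)) (Fin (k + 1)) ℂ :=
  fun r c => if r = c then 1 else if (r : ℕ) + 1 = k ∧ (c : ℕ) = k then a else 0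

end LOCC

/-! Call a product operator a stabilizer if it fixes the state up to a nonzero factor. The state is
weakly isolated once every stabilizer that is unitary away from one site is scalar at that site, and
no nonzero one-site operator kills the state. If party `i` measures and two outcomes `a`, `o` lead
to LU-equivalent states, then undoing `o` after `a` gives such a stabilizer. So all `(A a)ᴴ * A a`
are proportional to one another, and by completeness the measurement is a multiple of a unitary
(`LUEquiv.of_measurement`). Working back from the leaves of a protocol, this makes every state along
it LU-equivalent to the target.

To find the stabilizers, read `|E_k⟩` as the multilinear form sending `(x₁, …, xₙ)` to the
coefficient of `t ^ k` in `x₁ ⋯ xₙ`, over `ℂ[t] / (t ^ (k + 1))`. Invariance of this nondegenerate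
form forces any two factors to be a single algebra endomorphism `φ` followed by multiplication by
constants (`exists_algHom_of_trilinear_invariant`). Since `φ` preserves the powers of the ideal
`(t)`, the factors are triangular, and unitarity makes the unsheared factors diagonal. Conjugating
back by the shears gives one formula for `φ` per unitary site. Two distinct shears, or one nonzero
shear when `k ≥ 3`, leave only `φ = id` (`algHom_fixes_generator`). -/

namespace LOCC

/-! ### Algebra of product operators and one-site operators. -/

section LocalOperators

variable {n d : ℕ}

theorem localAct_localAct (A B : Fin n → Matrix (Fin d) (Fin d) ℂ) (ψ : State n d) :
    localAct A (localAct B ψ) = localAct (A * B) ψ := by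
  funext m
  simp only [localAct, Finset.mul_sum, Pi.mul_apply, Matrix.mul_apply]
  rw [Finset.sum_comm]
  refine Finset.sum_congr rfl fun l _ => ?_
  rw [Finset.prod_univ_sum, Fintype.piFinset_univ, Finset.sum_mul]
  refine Finset.sum_congr rfl fun x _ => ?_
  rw [Finset.prod_mul_distrib, mul_assoc]

theorem localAct_smul (A : Fin n → Matrix (Fin d) (Fin d) ℂ) (c : ℂ) (ψ : State n d) :
    localAct A (c • ψ) = c • localAct A ψ := by
  funext m
  simp only [localAct, Pi.smul_apply, smul_eq_mul, Finset.mul_sum]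
  exact Finset.sum_congr rfl fun x _ => by ring

theorem siteAct_eq_localAct (i : Fin n) (M : Matrix (Fin d) (Fin d) ℂ) (ψ : State n d) :
    siteAct i M ψ = localAct (Pi.mulSingle i M) ψ := rfl

theorem siteAct_apply (i : Fin n) (M : Matrix (Fin d) (Fin d) ℂ) (ψ : State n d)
    (m : Fin n → Fin d) :
    siteAct i M ψ m = ∑ c, M (m i) c * ψ (Function.update m i c) := by
  symm
  refine Finset.sum_of_injOn (fun c => Function.update m i c)
    (fun x _ y _ h => Function.update_injective m i h)
    (fun _ _ => Finset.mem_coe.2 (Finset.mem_univ _)) ?_ ?_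
  · intro l _ hl
    have : ∃ j, j ≠ i ∧ m j ≠ l j := by
      by_contra! h
      refine hl ⟨l i, by simp, ?_⟩
      funext j
      by_cases hj : j = i
      · subst hj; simp
      · simp [hj, h j hj]
    obtain ⟨j, hj, hjl⟩ := this
    rw [Finset.prod_eq_zero (Finset.mem_univ j), zero_mul]
    simp [hj, hjl]
  · intro c _
    rw [← Finset.mul_prod_erase _ _ (Finset.mem_univ i), Finset.prod_eq_one]
    · simp
    · intro j hj
      simp [Finset.ne_of_mem_erase hj]

theorem localAct_one (ψ : State n d) : localAct 1 ψ = ψ := by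
  funext m
  rw [localAct, Finset.sum_eq_single m]
  · simp
  · intro l _ hl
    obtain ⟨j, hj⟩ := Function.ne_iff.1 hl
    rw [Finset.prod_eq_zero (Finset.mem_univ j), zero_mul]
    simp [Ne.symm hj]
  · simp

theorem siteAct_one (i : Fin n) (ψ : State n d) : siteAct i 1 ψ = ψ := by
  rw [siteAct_eq_localAct, Pi.mulSingle_one, localAct_one]

theorem siteAct_siteAct (i : Fin n) (M N : Matrix (Fin d) (Fin d) ℂ) (ψ : State n d) :
    siteAct i M (siteAct i N ψ) = siteAct i (M * N) ψ := by
  simp only [siteAct_eq_localAct, localAct_localAct, Pi.mulSingle_mul]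

theorem siteAct_zero_state (i : Fin n) (M : Matrix (Fin d) (Fin d) ℂ) :
    siteAct i M (0 : State n d) = 0 := by
  funext m; simp [siteAct_apply]

theorem siteAct_zero (i : Fin n) (ψ : State n d) : siteAct i 0 ψ = 0 := by
  funext m; simp [siteAct_apply]

theorem siteAct_smul (i : Fin n) (s : ℂ) (M : Matrix (Fin d) (Fin d) ℂ) (ψ : State n d) :
    siteAct i (s • M) ψ = s • siteAct i M ψ := by
  funext m; simp [siteAct_apply, Finset.mul_sum, mul_assoc]

theorem siteAct_sum {r : ℕ} (i : Fin n) (M : Fin r → Matrix (Fin d) (Fin d) ℂ) (ψ : State n d) :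
    siteAct i (∑ a, M a) ψ = ∑ a, siteAct i (M a) ψ := by
  funext m
  simp only [siteAct_apply, Finset.sum_apply, Matrix.sum_apply, Finset.sum_mul]
  exact Finset.sum_comm

end LocalOperators

/-! ### Local unitary equivalence. -/

section LocalUnitaries

variable {n d : ℕ}

theorem localAct_inv_localAct (U : Fin n → Matrix.unitaryGroup (Fin d) ℂ) (ψ : State n d) :
    localAct (fun j => ((U j)⁻¹ : Matrix.unitaryGroup (Fin d) ℂ).1) (localAct (fun j => (U j).1) ψ)
      = ψ := by
  rw [localAct_localAct]
  convert localAct_one ψ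
  funext j
  simp only [Pi.mul_apply, Pi.one_apply]
  exact Matrix.UnitaryGroup.star_mul_self (U j)

theorem LUEquiv.symm {ψ φ : State n d} (h : LUEquiv ψ φ) : LUEquiv φ ψ := by
  obtain ⟨U, c, hc, rfl⟩ := h
  refine ⟨fun j => (U j)⁻¹, c⁻¹, inv_ne_zero hc, ?_⟩
  rw [localAct_smul, smul_smul, inv_mul_cancel₀ hc, one_smul, localAct_inv_localAct]

theorem LUEquiv.trans {ψ φ χ : State n d} (h : LUEquiv ψ φ) (h' : LUEquiv φ χ) :
    LUEquiv ψ χ := by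
  obtain ⟨U, c, hc, rfl⟩ := h
  obtain ⟨V, e, he, rfl⟩ := h'
  refine ⟨fun j => U j * V j, c * e, mul_ne_zero hc he, ?_⟩
  rw [localAct_smul, smul_smul, localAct_localAct]
  rfl

theorem LUEquiv.of_smul {c : ℂ} (hc : c ≠ 0) (φ : State n d) : LUEquiv (c • φ) φ := by
  refine ⟨fun _ => 1, c, hc, ?_⟩
  congr 1
  exact (localAct_one φ).symm

theorem LUEquiv.siteAct_of_mem_unitaryGroup (i : Fin n) {W : Matrix (Fin d) (Fin d) ℂ}
    (hW : W ∈ Matrix.unitaryGroup (Fin d) ℂ) (ψ : State n d) : LUEquiv (siteAct i W ψ) ψ := by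
  refine ⟨Pi.mulSingle i ⟨W, hW⟩, 1, one_ne_zero, ?_⟩
  rw [one_smul, siteAct_eq_localAct]
  congr 1
  funext j
  by_cases hj : j = i
  · subst hj; simp
  · simp [hj]

end LocalUnitaries

/-! ### States that no nonzero one-site operator annihilates. -/

section Nondegeneracy

variable {n d : ℕ}

/-- No nonzero operator on a single site annihilates the state. -/
def SiteNondegenerate (ψ : State n d) : Prop :=
  ∀ (i : Fin n) (M : Matrix (Fin d) (Fin d) ℂ), siteAct i M ψ = 0 → M = 0

theorem SiteNondegenerate.localAct {ψ : State n d} (h : SiteNondegenerate ψ)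
    {A : Fin n → Matrix (Fin d) (Fin d) ℂ} (hA : IsUnit A) :
    SiteNondegenerate (localAct A ψ) := by
  obtain ⟨u, rfl⟩ := hA
  intro i M hM
  have h1 : siteAct i ((↑u⁻¹ : Fin n → Matrix (Fin d) (Fin d) ℂ) i * M * u.1 i) ψ = 0 := by
    have h2 : (Pi.mulSingle i ((↑u⁻¹ : Fin n → Matrix (Fin d) (Fin d) ℂ) i * M * u.1 i) :
        Fin n → Matrix (Fin d) (Fin d) ℂ) =
        (↑u⁻¹ : Fin n → Matrix (Fin d) (Fin d) ℂ) * Pi.mulSingle i M * u.1 := by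
      funext j
      by_cases hj : j = i
      · subst hj; simp
      · simp only [ne_eq, hj, not_false_eq_true, Pi.mulSingle_eq_of_ne, Pi.mul_apply, mul_one]
        exact (congrFun u.inv_mul j).symm
    rw [siteAct_eq_localAct, h2, ← localAct_localAct, ← localAct_localAct,
      ← siteAct_eq_localAct, hM]
    funext m
    simp [LOCC.localAct]
  have h3 := h i _ h1
  have h4 : u.1 i * (↑u⁻¹ : Fin n → Matrix (Fin d) (Fin d) ℂ) i = 1 := congrFun u.mul_inv i
  calc M = (u.1 i * (↑u⁻¹ : Fin n → Matrix (Fin d) (Fin d) ℂ) i) * M *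
        (u.1 i * (↑u⁻¹ : Fin n → Matrix (Fin d) (Fin d) ℂ) i) := by rw [h4]; simp
    _ = u.1 i * ((↑u⁻¹ : Fin n → Matrix (Fin d) (Fin d) ℂ) i * M * u.1 i)
        * (↑u⁻¹ : Fin n → Matrix (Fin d) (Fin d) ℂ) i := by
      simp only [mul_assoc]
    _ = 0 := by rw [h3]; simp

theorem SiteNondegenerate.smul {ψ : State n d} (h : SiteNondegenerate ψ) {c : ℂ} (hc : c ≠ 0) :
    SiteNondegenerate (c • ψ) := by
  intro i M hM
  rw [siteAct_eq_localAct, localAct_smul] at hM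
  exact h i M ((smul_eq_zero.1 hM).resolve_left hc)

theorem SiteNondegenerate.of_LUEquiv {ψ φ : State n d} (h : SiteNondegenerate φ)
    (hl : LUEquiv ψ φ) : SiteNondegenerate ψ := by
  obtain ⟨U, c, hc, rfl⟩ := hl
  refine (h.localAct ?_).smul hc
  rw [Pi.isUnit_iff]
  exact fun j => ⟨Unitary.toUnits (U j), rfl⟩

theorem SiteNondegenerate.isUnit_of_siteAct {ψ : State n d} {i : Fin n}
    {A : Matrix (Fin d) (Fin d) ℂ} (h : SiteNondegenerate (siteAct i A ψ)) : IsUnit A := by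
  rw [Matrix.isUnit_iff_isUnit_det, isUnit_iff_ne_zero]
  intro h0
  obtain ⟨v, hv, hvA⟩ := Matrix.exists_vecMul_eq_zero_iff.2 h0
  -- A left null vector of `A`, repeated in every row, is a one-site operator annihilating the
  -- measured state.
  have hN : (Matrix.of fun _ : Fin d => v) * A = 0 := by
    ext a b
    exact congrFun hvA b
  have := h i (Matrix.of fun _ : Fin d => v) (by rw [siteAct_siteAct, hN, siteAct_zero])
  refine hv ?_
  funext b
  exact congrFun (congrFun this b) b

/-- `M * reducedDensity ψ i` is the partial trace of `M|ψ⟩⟨ψ|`, so it vanishes with `M|ψ⟩`, while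
the density matrix is invertible. -/
theorem FullyEntangled.siteNondegenerate {ψ : State n d} (h : FullyEntangled ψ) :
    SiteNondegenerate ψ := by
  intro i M hM
  have hu : IsUnit (reducedDensity ψ i) := by
    rw [← Matrix.mulVec_surjective_iff_isUnit]
    have : LinearMap.range (reducedDensity ψ i).mulVecLin = ⊤ :=
      Submodule.eq_top_of_finrank_eq (by
        rw [Module.finrank_fin_fun]
        exact h i)
    exact LinearMap.range_eq_top.1 this
  suffices hz : M * reducedDensity ψ i = 0 from hu.mul_left_eq_zero.1 hz
  ext a b
  -- Reindexing makes the range of summation independent of `c`, so the sum over `c` produces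
  -- `siteAct i M ψ`.
  have key : ∀ c, reducedDensity ψ i c b = ∑ m : Fin n → Fin d,
      if m i = a then ψ (Function.update m i c) * star (ψ (Function.update m i b)) else 0 := by
    intro c
    simp only [reducedDensity]
    rw [← Finset.sum_filter, ← Finset.sum_filter]
    refine Finset.sum_bij' (fun m _ => Function.update m i a) (fun m _ => Function.update m i c)
      ?_ ?_ ?_ ?_ ?_
    · intro m _; simp
    · intro m _; simp
    · intro m hm; simp [← (Finset.mem_filter.1 hm).2]
    · intro m hm; simp [← (Finset.mem_filter.1 hm).2]
    · intro m hm; simp [← (Finset.mem_filter.1 hm).2]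
  rw [Matrix.mul_apply]
  simp only [key, Finset.mul_sum]
  rw [Finset.sum_comm, Matrix.zero_apply]
  refine Finset.sum_eq_zero fun m _ => ?_
  split_ifs with hm
  · have := congrFun hM m
    rw [siteAct_apply, hm] at this
    simp only [← mul_assoc, ← Finset.sum_mul]
    rw [this]; simp
  · simp

end Nondegeneracy

/-! ### From scalar stabilizers to weak isolation. -/

section Protocols

variable {n d : ℕ}

/-- Every product operator that fixes the state up to a factor and is unitary off site `i` is
scalar at site `i`. -/
def ScalarStabilizerAt (i : Fin n) (ψ : State n d) : Prop :=
  ∀ B : Fin n → Matrix (Fin d) (Fin d) ℂ, (∀ j, j ≠ i → B j ∈ Matrix.unitaryGroup (Fin d) ℂ) →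
    ∀ c : ℂ, c ≠ 0 → localAct B ψ = c • ψ → ∃ s : ℂ, B i = s • 1

/-- Conjugating by `A` at site `i` and by the local unitaries carries stabilizers of `ψ` to
stabilizers of `φ`. It keeps unitarity away from `i`, and a conjugate of a scalar is scalar. -/
theorem ScalarStabilizerAt.of_siteAct {i : Fin n} {ψ φ : State n d}
    (h : ScalarStabilizerAt i φ) {A : Matrix (Fin d) (Fin d) ℂ} (hA : IsUnit A)
    (hl : LUEquiv (siteAct i A ψ) φ) : ScalarStabilizerAt i ψ := by
  obtain ⟨u, rfl⟩ := hA
  obtain ⟨U, c, hc, hφ⟩ := hl.symm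
  intro B hB e he hBe
  have hinv : siteAct i (↑u⁻¹ : Matrix (Fin d) (Fin d) ℂ) (siteAct i u.1 ψ) = ψ := by
    rw [siteAct_siteAct, u.inv_mul, siteAct_one]
  have hstab : localAct ((fun j => (U j).1) * Pi.mulSingle i u.1 * B * Pi.mulSingle i
      (↑u⁻¹ : Matrix (Fin d) (Fin d) ℂ) * fun j => ((U j)⁻¹ : Matrix.unitaryGroup (Fin d) ℂ).1) φ
      = e • φ := by
    simp only [← localAct_localAct]
    rw [hφ]
    simp only [localAct_smul]
    rw [localAct_inv_localAct, ← siteAct_eq_localAct, ← siteAct_eq_localAct, hinv, hBe,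
      siteAct_eq_localAct, localAct_smul, localAct_smul, smul_comm]
    rfl
  obtain ⟨s, hs⟩ := h _ (fun j hj => by
    simp only [Pi.mul_apply, Pi.mulSingle_eq_of_ne hj, mul_one]
    exact mul_mem (mul_mem (U j).2 (hB j hj)) ((U j)⁻¹).2) e he hstab
  refine ⟨s, ?_⟩
  simp only [Pi.mul_apply, Pi.mulSingle_eq_same] at hs
  have hU : ((U i)⁻¹ : Matrix.unitaryGroup (Fin d) ℂ).1 * (U i).1 = 1 :=
    Matrix.UnitaryGroup.star_mul_self (U i)
  calc B i = ↑u⁻¹ * (((U i)⁻¹ : Matrix.unitaryGroup (Fin d) ℂ).1 * (U i).1) * u.1 * B i * ↑u⁻¹ *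
        (((U i)⁻¹ : Matrix.unitaryGroup (Fin d) ℂ).1 * (U i).1) * u.1 := by
        rw [hU]; simp [mul_assoc]
    _ = ↑u⁻¹ * ((U i)⁻¹ : Matrix.unitaryGroup (Fin d) ℂ).1 * ((U i).1 * u.1 * B i * ↑u⁻¹ *
        ((U i)⁻¹ : Matrix.unitaryGroup (Fin d) ℂ).1) * (U i).1 * u.1 := by
        simp only [mul_assoc]
    _ = s • (↑u⁻¹ * (((U i)⁻¹ : Matrix.unitaryGroup (Fin d) ℂ).1 * (U i).1) * u.1) := by
        rw [hs]; simp [mul_assoc]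
    _ = s • 1 := by rw [hU]; simp

theorem exists_siteAct_ne_zero {i : Fin n} {ψ : State n d} (hψ : ψ ≠ 0) {r : ℕ}
    {A : Fin r → Matrix (Fin d) (Fin d) ℂ} (hA : ∑ a, (A a).conjTranspose * A a = 1) :
    ∃ a, siteAct i (A a) ψ ≠ 0 := by
  by_contra! h
  apply hψ
  rw [← siteAct_one i ψ, ← hA, siteAct_sum]
  exact Finset.sum_eq_zero fun a _ => by rw [← siteAct_siteAct, h, siteAct_zero_state]

theorem LUEquiv.of_measurement {i : Fin n} {ψ φ : State n d} (hψ : ψ ≠ 0)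
    (hψn : SiteNondegenerate ψ) (hφn : SiteNondegenerate φ) (hs : ScalarStabilizerAt i ψ) {r : ℕ}
    {A : Fin r → Matrix (Fin d) (Fin d) ℂ} (hA : ∑ a, (A a).conjTranspose * A a = 1)
    (h : ∀ a, siteAct i (A a) ψ ≠ 0 → LUEquiv (siteAct i (A a) ψ) φ) : LUEquiv ψ φ := by
  obtain ⟨o, ho⟩ := exists_siteAct_ne_zero (i := i) hψ hA
  obtain ⟨u, hu⟩ := (hφn.of_LUEquiv (h o ho)).isUnit_of_siteAct
  have hgram : ∀ a, ∃ s : ℝ, 0 ≤ s ∧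
      (A a).conjTranspose * A a = (s : ℂ) • ((A o).conjTranspose * A o) := by
    intro a
    by_cases ha : siteAct i (A a) ψ = 0
    -- By nondegeneracy an outcome of probability zero has a zero measurement operator.
    · exact ⟨0, le_rfl, by simp [hψn i _ ha]⟩
    obtain ⟨U, c, hc, hU⟩ := (h o ho).trans (h a ha).symm
    have hfix : siteAct i (↑u⁻¹ : Matrix (Fin d) (Fin d) ℂ) (siteAct i (A o) ψ) = ψ := by
      rw [siteAct_siteAct, ← hu, u.inv_mul, siteAct_one]
    -- Apply outcome `a`, rotate to the state of outcome `o`, then undo `A o`: the factor at `i` is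
    -- `(A o)⁻¹ * U i * A a`.
    have hstab : localAct (Pi.mulSingle i (↑u⁻¹ : Matrix (Fin d) (Fin d) ℂ) *
        (fun j => (U j).1) * Pi.mulSingle i (A a)) ψ = c⁻¹ • ψ := by
      rw [← localAct_localAct, ← localAct_localAct, eq_inv_smul_iff₀ hc, ← localAct_smul,
        ← siteAct_eq_localAct i (A a), ← hU, ← siteAct_eq_localAct, hfix]
    obtain ⟨s, hs⟩ := hs _ (fun j hj => by
      simp only [Pi.mul_apply, Pi.mulSingle_eq_of_ne hj, mul_one, one_mul]
      exact (U j).2) _ (inv_ne_zero hc) hstab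
    simp only [Pi.mul_apply, Pi.mulSingle_eq_same] at hs
    have hUU : (U i).1.conjTranspose * (U i).1 = 1 := Matrix.UnitaryGroup.star_mul_self (U i)
    have hUA : (U i).1 * A a = s • A o := by
      calc (U i).1 * A a = u.1 * (↑u⁻¹ * (U i).1 * A a) := by
            rw [mul_assoc, ← mul_assoc u.1, u.mul_inv, one_mul]
        _ = s • A o := by rw [hs, hu]; simp
    refine ⟨Complex.normSq s, Complex.normSq_nonneg s, ?_⟩
    calc (A a).conjTranspose * A a
        = ((U i).1 * A a).conjTranspose * ((U i).1 * A a) := by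
          rw [Matrix.conjTranspose_mul, mul_assoc, ← mul_assoc _ (U i).1, hUU, one_mul]
      _ = _ := by
          rw [hUA, Matrix.conjTranspose_smul, Matrix.smul_mul, Matrix.mul_smul, smul_smul,
            Complex.normSq_eq_conj_mul_self]
          rfl
  choose s hs0 hs using hgram
  have h1 : ((∑ a, s a : ℝ) : ℂ) • ((A o).conjTranspose * A o) = 1 := by
    rw [← hA, Finset.sum_congr rfl fun a _ => hs a, ← Finset.sum_smul]
    push_cast; rfl
  have hpos : 0 < ∑ a, s a := by
    refine lt_of_le_of_ne (Finset.sum_nonneg fun a _ => hs0 a) fun h0 => hψ ?_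
    rw [← siteAct_one i ψ, ← h1, ← h0, siteAct_smul]
    simp
  set q : ℝ := ∑ a, s a
  have hq : (√q : ℂ) ≠ 0 := by exact_mod_cast (Real.sqrt_pos.2 hpos).ne'
  have hW : (√q : ℂ) • A o ∈ Matrix.unitaryGroup (Fin d) ℂ := by
    rw [Matrix.mem_unitaryGroup_iff', star_smul, Matrix.smul_mul, Matrix.mul_smul, smul_smul,
      ← h1]
    congr 1
    rw [← starRingEnd_apply, Complex.conj_ofReal, ← Complex.ofReal_mul,
      Real.mul_self_sqrt hpos.le]
  have h2 := LUEquiv.siteAct_of_mem_unitaryGroup i hW ψ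
  rw [siteAct_smul] at h2
  exact h2.symm.trans ((LUEquiv.of_smul hq _).trans (h o ho))

/-- Induction from the leaves: the states after a round are already LU-equivalent to `φ`, so one
possible outcome has an invertible operator. Through it both stabilizer and nondegeneracy conditions
pass back to `ψ`. -/
theorem Protocol.Converts.LUEquiv {φ : State n d} (hφn : SiteNondegenerate φ)
    (hs : ∀ i, ScalarStabilizerAt i φ) (P : Protocol n d) :
    ∀ ψ : State n d, ψ ≠ 0 → P.Converts ψ φ → LUEquiv ψ φ := by
  induction P with
  | finish =>
    rintro ψ - ⟨c, hc, rfl⟩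
    exact LUEquiv.of_smul hc φ
  | round i r A hA next ih =>
    intro ψ hψ hP
    have hA' : ∀ a, siteAct i (A a) ψ ≠ 0 → LOCC.LUEquiv (siteAct i (A a) ψ) φ :=
      fun a ha => ih a _ ha (hP a ha)
    obtain ⟨o, ho⟩ := exists_siteAct_ne_zero (i := i) hψ hA
    have hn := hφn.of_LUEquiv (hA' o ho)
    have hu := hn.isUnit_of_siteAct
    have hψn : SiteNondegenerate ψ := by
      obtain ⟨u, hu⟩ := hu
      have : siteAct i (↑u⁻¹ : Matrix (Fin d) (Fin d) ℂ) (siteAct i (A o) ψ) = ψ := by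
        rw [siteAct_siteAct, ← hu, u.inv_mul, siteAct_one]
      rw [← this]
      refine hn.localAct (Pi.isUnit_iff.2 fun j => ?_)
      by_cases hj : j = i
      · subst hj
        simp
      · simp [hj]
    exact LUEquiv.of_measurement hψ hψn hφn ((hs i).of_siteAct hu (hA' o ho)) hA hA'

theorem weaklyIsolated_of_scalarStabilizerAt {φ : State n d} (hφ : φ ≠ 0)
    (hφn : SiteNondegenerate φ) (hs : ∀ i, ScalarStabilizerAt i φ) : WeaklyIsolated φ := by
  constructor
  · rintro ⟨ψ, hψ, hne, P, hP⟩
    exact hne (hP.LUEquiv hφn hs P ψ hψ)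
  · rintro ⟨χ, hχ, hne, i, r, A, hA, h⟩
    exact hne (LUEquiv.of_measurement hφ hφn hχ.siteNondegenerate (hs i) hA h)

end Protocols

end LOCC

/-! ### Symmetries of the trilinear form of a commutative Frobenius algebra. -/

section FrobeniusForm

variable {A : Type*} [CommRing A] [Algebra ℂ A] [FiniteDimensional ℂ A]

/-- As `T` is onto and the form is nondegenerate, `P y * Q z` depends only on `y * z`. Hence `P 1`,
`Q 1` are units, and `P`, `Q` divided by them are the same multiplicative map. -/
theorem exists_algHom_of_trilinear_invariant (lam : A →ₗ[ℂ] ℂ)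
    (hlam : ∀ x, (∀ y, lam (x * y) = 0) → x = 0) (T P Q : A →ₗ[ℂ] A) {c : ℂ} (hc : c ≠ 0)
    (h : ∀ x y z, lam (T x * P y * Q z) = c * lam (x * y * z)) :
    ∃ φ : A →ₐ[ℂ] A, Function.Injective φ ∧ (∀ y, P y = P 1 * φ y) ∧
      ∀ y, Q y = Q 1 * φ y := by
  have hT : Function.Injective T := (injective_iff_map_eq_zero T).2 fun x hx =>
    hlam x fun y => by simpa [hx, hc] using h x y 1
  have hP : Function.Injective P := (injective_iff_map_eq_zero P).2 fun x hx =>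
    hlam x fun y => by simpa [hx, hc, mul_comm] using h y x 1
  have hQ : Function.Injective Q := (injective_iff_map_eq_zero Q).2 fun x hx =>
    hlam x fun y => by simpa [hx, hc, mul_comm] using h 1 y x
  have hT' := LinearMap.injective_iff_surjective.1 hT
  have hP' := LinearMap.injective_iff_surjective.1 hP
  have hQ' := LinearMap.injective_iff_surjective.1 hQ
  have hPQ : ∀ y z y' z', y * z = y' * z' → P y * Q z = P y' * Q z' := by
    intro y z y' z' hyz
    refine sub_eq_zero.1 (hlam _ fun w => ?_)
    obtain ⟨x, rfl⟩ := hT' w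
    have h1 := h x y z
    have h2 := h x y' z'
    rw [mul_assoc x, hyz, ← mul_assoc x, ← h2] at h1
    rw [sub_mul, map_sub, mul_comm _ (T x), mul_comm _ (T x), ← mul_assoc, ← mul_assoc, h1,
      sub_self]
  obtain ⟨y₀, hy₀⟩ := hP' 1
  obtain ⟨z₀, hz₀⟩ := hQ' 1
  -- `P (y₀ * z₀) * Q 1 = P y₀ * Q z₀ = 1`.
  have hQ1 : IsUnit (Q 1) := by
    refine IsUnit.of_mul_eq_one (P (y₀ * z₀)) ?_
    rw [mul_comm, ← hPQ y₀ z₀ (y₀ * z₀) 1 (mul_one _).symm, hy₀, hz₀, mul_one]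
  have hP1 : IsUnit (P 1) := by
    refine IsUnit.of_mul_eq_one (Q (y₀ * z₀)) ?_
    rw [← hPQ y₀ z₀ 1 (y₀ * z₀) (one_mul _).symm, hy₀, hz₀, mul_one]
  obtain ⟨u, hu⟩ := hP1
  have hcross : ∀ y, P y * Q 1 = P 1 * Q y := fun y => hPQ y 1 1 y (by ring)
  have hmul : ∀ y z, P 1 * P (y * z) = P y * P z := by
    intro y z
    apply hQ1.mul_right_cancel
    rw [mul_assoc, hPQ (y * z) 1 y z (mul_one _), mul_assoc (P y), hcross]
    ring
  let φ : A →ₐ[ℂ] A := AlgHom.ofLinearMap (LinearMap.mulLeft ℂ (↑u⁻¹ : A) ∘ₗ P)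
    (by simp [← hu]) (fun y z => by
      simp only [LinearMap.comp_apply, LinearMap.mulLeft_apply]
      calc ↑u⁻¹ * P (y * z) = ↑u⁻¹ * ↑u⁻¹ * (u * P (y * z)) := by
            rw [mul_assoc, Units.inv_mul_cancel_left]
        _ = _ := by rw [hu, hmul]; ring)
  have hφ : ∀ y, φ y = ↑u⁻¹ * P y := fun y => rfl
  refine ⟨φ, fun x y hxy => ?_, fun y => ?_, fun y => ?_⟩
  · rw [hφ, hφ] at hxy
    exact hP (u⁻¹.isUnit.mul_left_cancel hxy)
  · rw [hφ, ← hu, Units.mul_inv_cancel_left]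
  · apply u.isUnit.mul_left_cancel
    rw [hφ, mul_left_comm (Q 1), Units.mul_inv_cancel_left, mul_comm (Q 1), hcross, hu]

end FrobeniusForm

/-! ### The algebra `ℂ[t] / (t ^ (k + 1))` and its endomorphisms. -/

section TruncatedPolynomials

variable {A : Type*} [CommRing A] [Algebra ℂ A] {k : ℕ} {t : A}
  {b : Module.Basis (Fin (k + 1)) ℂ A}

theorem repr_pow_of_powers (hb : ∀ m, b m = t ^ (m : ℕ)) (ht : t ^ (k + 1) = 0) (N : ℕ)
    (l : Fin (k + 1)) : b.repr (t ^ N) l = if N = l then 1 else 0 := by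
  by_cases hN : N < k + 1
  · have : t ^ N = b ⟨N, hN⟩ := (hb ⟨N, hN⟩).symm
    rw [this, b.repr_self, Finsupp.single_apply]
    simp [Fin.ext_iff]
  · rw [pow_eq_zero_of_le (not_lt.1 hN) ht, if_neg (by have := l.2; omega)]
    simp

theorem repr_pow_mul_of_powers (hb : ∀ m, b m = t ^ (m : ℕ)) (ht : t ^ (k + 1) = 0) (N : ℕ)
    (x : A) (l : Fin (k + 1)) :
    b.repr (t ^ N * x) l = ∑ c, b.repr x c * if N + c = l then 1 else 0 := by
  conv_lhs => rw [← b.sum_repr x, Finset.mul_sum]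
  simp only [mul_smul_comm, hb, ← pow_add, map_sum, map_smul, Finsupp.coe_finsetSum,
    Finset.sum_apply, Finsupp.smul_apply, smul_eq_mul, repr_pow_of_powers hb ht]

theorem repr_pow_mul_eq_zero_of_lt (hb : ∀ m, b m = t ^ (m : ℕ)) (ht : t ^ (k + 1) = 0) {N : ℕ}
    (x : A) {l : Fin (k + 1)} (hl : (l : ℕ) < N) : b.repr (t ^ N * x) l = 0 := by
  rw [repr_pow_mul_of_powers hb ht]
  exact Finset.sum_eq_zero fun c _ => by rw [if_neg (by omega), mul_zero]

theorem eq_zero_of_coord_last_mul (hb : ∀ m, b m = t ^ (m : ℕ)) (ht : t ^ (k + 1) = 0) (x : A)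
    (hx : ∀ y, b.coord (Fin.last k) (x * y) = 0) : x = 0 := by
  rw [← b.repr.map_eq_zero_iff]
  ext l
  -- Multiplication by `t ^ (k - l)` moves the coefficient of `t ^ l` to the top degree.
  have := hx (t ^ (k - l : ℕ))
  rw [mul_comm, b.coord_apply, repr_pow_mul_of_powers hb ht, Finset.sum_eq_single l] at this
  · rw [if_pos (by simp; omega), mul_one] at this
    simpa using this
  · intro c _ hc
    rw [if_neg, mul_zero]
    intro h
    apply hc
    ext
    simp at h
    omega
  · simp

theorem exists_mul_of_isNilpotent (hb : ∀ m, b m = t ^ (m : ℕ)) (ht : t ^ (k + 1) = 0) {x : A}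
    (hx : IsNilpotent x) : ∃ y, x = t * y := by
  have : Nontrivial A := ⟨b 0, 0, b.ne_zero 0⟩
  obtain ⟨y, hy⟩ : ∃ y, x = algebraMap ℂ A (b.repr x 0) + t * y := by
    refine ⟨∑ c : Fin k, b.repr x c.succ • t ^ (c : ℕ), ?_⟩
    conv_lhs => rw [← b.sum_repr x, Fin.sum_univ_succ]
    rw [Finset.mul_sum, Algebra.algebraMap_eq_smul_one]
    simp [hb, pow_succ']
  have hn : IsNilpotent (algebraMap ℂ A (b.repr x 0)) := by
    rw [← sub_eq_iff_eq_add] at hy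
    rw [← hy]
    exact (Commute.all _ _).isNilpotent_sub hx ((Commute.all _ _).isNilpotent_mul_right ⟨_, ht⟩)
  rw [isNilpotent_iff_eq_zero.1
    ((IsNilpotent.map_iff (FaithfulSMul.algebraMap_injective ℂ A)).1 hn)] at hy
  exact ⟨y, by simpa using hy⟩

/-- `φ t` is nilpotent, hence divisible by `t`, so `φ (t ^ N)` is divisible by `t ^ N`. -/
theorem repr_algHom_pow_eq_zero_of_lt (hb : ∀ m, b m = t ^ (m : ℕ)) (ht : t ^ (k + 1) = 0)
    (φ : A →ₐ[ℂ] A) (u : A) {N : ℕ} {l : Fin (k + 1)} (hl : (l : ℕ) < N) :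
    b.repr (u * φ (t ^ N)) l = 0 := by
  obtain ⟨y, hy⟩ := exists_mul_of_isNilpotent hb ht (x := φ t)
    ⟨k + 1, by rw [← map_pow, ht, map_zero]⟩
  rw [map_pow, hy, mul_pow, mul_left_comm]
  exact repr_pow_mul_eq_zero_of_lt hb ht _ hl

/-- The two formulas are what two sheared diagonal unitaries say about the same `φ`. They force `δ
(k - 1) = δ k`; then `φ t = δ 1 • t`, so `δ m = δ 1 ^ m`, and `δ 1 ^ (k - 1) = δ 1 ^ k ≠ 0` gives `δ
1 = 1`. -/
theorem algHom_fixes_generator (hb : ∀ m, b m = t ^ (m : ℕ)) (ht : t ^ (k + 1) = 0)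
    (hk : 2 ≤ k) (φ : A →ₐ[ℂ] A) (hφ : Function.Injective φ) {a a' : ℂ}
    (ha : a ≠ a' ∨ 3 ≤ k ∧ a ≠ 0) {δ δ' : ℕ → ℂ}
    (h : ∀ m ≤ k, φ (t ^ m) = δ m • t ^ m + if m + 1 = k then (a * (δ m - δ k)) • t ^ k else 0)
    (h' : ∀ m ≤ k,
      φ (t ^ m) = δ' m • t ^ m + if m + 1 = k then (a' * (δ' m - δ' k)) • t ^ k else 0) :
    φ t = t := by
  have hr := fun N l => repr_pow_of_powers (l := l) hb ht N
  obtain ⟨r, rfl⟩ : ∃ r, k = r + 1 := ⟨k - 1, by omega⟩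
  have hk1 := h (r + 1) le_rfl
  have hk1' := h' (r + 1) le_rfl
  have hr1 := h r (by omega)
  have hr1' := h' r (by omega)
  simp only [if_true, Nat.add_eq_left, one_ne_zero, if_false, add_zero] at hk1 hk1' hr1 hr1'
  have ek : δ (r + 1) = δ' (r + 1) := by
    have := congrArg (fun x => b.repr x (Fin.last (r + 1))) (hk1.symm.trans hk1')
    simpa [hr] using this
  have er : δ r = δ' r := by
    have := congrArg (fun x => b.repr x (Fin.last r).castSucc) (hr1.symm.trans hr1')
    simpa [hr] using this
  have ea : a * (δ r - δ (r + 1)) = a' * (δ r - δ (r + 1)) := by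
    have := congrArg (fun x => b.repr x (Fin.last (r + 1))) (hr1.symm.trans hr1')
    simpa [hr, ← er, ← ek] using this
  have hδ : δ r = δ (r + 1) := by
    rcases ha with ha | ⟨hk3, ha⟩
    · by_contra hne
      exact ha (mul_right_cancel₀ (sub_ne_zero.2 hne) ea)
    -- For `k ≥ 3` the generator is not `t ^ (k - 1)`, so `φ t` is a multiple of `t` and `φ (t ^ (k
    -- - 1))` has no `t ^ k` term.
    · have h1 := h 1 (by omega)
      rw [if_neg (by omega), add_zero, pow_one] at h1
      rw [map_pow, h1, smul_pow] at hr1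
      have := congrArg (fun x => b.repr x (Fin.last (r + 1))) hr1
      simp [hr, ha] at this
      exact sub_eq_zero.1 this
  have h1 : φ t = δ 1 • t := by
    have h1 := h 1 (by omega)
    rw [pow_one] at h1
    rw [h1]
    split_ifs with h2
    -- For `k = 2` the correction falls on `t` itself, and vanishes by `hδ`.
    · obtain rfl : r = 1 := by omega
      rw [hδ]; simp
    · simp
  have hpow : ∀ m ≤ r + 1, δ 1 ^ m = δ m := by
    intro m hm
    have h2 := h m hm
    rw [map_pow, h1, smul_pow] at h2
    have := congrArg (fun x => b.repr x ⟨m, by omega⟩) h2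
    split_ifs at this with h3
    · obtain rfl : m = r := by omega
      simpa [hr] using this
    · simpa [hr] using this
  have hne : δ (r + 1) ≠ 0 := by
    intro h0
    rw [h0, zero_smul, map_eq_zero_iff φ hφ] at hk1
    have := hr (r + 1) (Fin.last (r + 1))
    simp [hk1] at this
  rw [← hpow r (by omega), ← hpow (r + 1) le_rfl] at hδ
  rw [← hpow (r + 1) le_rfl, ← hδ] at hne
  rw [pow_succ] at hδ
  have : δ 1 = 1 := (mul_right_eq_self₀.1 hδ.symm).resolve_right hne
  rw [h1, this, one_smul]

end TruncatedPolynomials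

/-- Witness for the truncated polynomial algebra `ℂ[t] / (t ^ (k + 1))`. -/
theorem exists_truncated_polynomial_basis (k : ℕ) :
    ∃ (A : Type) (_ : CommRing A) (_ : Algebra ℂ A) (t : A)
      (b : Module.Basis (Fin (k + 1)) ℂ A), (∀ m, b m = t ^ (m : ℕ)) ∧ t ^ (k + 1) = 0 := by
  let f : Polynomial ℂ := Polynomial.X ^ (k + 1)
  have hf : f.Monic := Polynomial.monic_X_pow _
  have hd : (AdjoinRoot.powerBasis' hf).dim = k + 1 := by
    rw [AdjoinRoot.powerBasis'_dim]; exact Polynomial.natDegree_X_pow _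
  refine ⟨AdjoinRoot f, inferInstance, inferInstance, AdjoinRoot.root f,
    (AdjoinRoot.powerBasis' hf).basis.reindex (finCongr hd), fun m => ?_, ?_⟩
  · simp
  · have : AdjoinRoot.mk f f = 0 := AdjoinRoot.mk_self
    rwa [map_pow, AdjoinRoot.mk_X] at this

namespace LOCC

/-! ### The excitation state as the top-coefficient form. -/

section Excitation

variable {n k : ℕ}

theorem siteNondegenerate_excitationState (hn : 2 ≤ n) :
    SiteNondegenerate (excitationState n k) := by
  intro i M hM
  have : Nontrivial (Fin n) := Fin.nontrivial_iff_two_le.2 hn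
  obtain ⟨j, hj⟩ := exists_ne i
  ext r c
  -- With `k - c` excitations at `j` and none at the remaining sites, only the value `c` at site `i`
  -- completes the total to `k`. This isolates the entry `M r c`.
  let m : Fin n → Fin (k + 1) :=
    Function.update (Function.update 0 j ⟨k - c, by omega⟩) i r
  have hsum : ∀ e : Fin (k + 1),
      ∑ l, ((Function.update m i e l : Fin (k + 1)) : ℕ) = e + (k - c) := by
    intro e
    rw [← Finset.add_sum_erase _ _ (Finset.mem_univ i),
      ← Finset.add_sum_erase _ _ (Finset.mem_erase.2 ⟨hj, Finset.mem_univ j⟩),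
      Finset.sum_eq_zero]
    · simp [m, hj]
    · intro l hl
      simp only [Finset.mem_erase, Finset.mem_univ, and_true] at hl
      simp [m, hl.1, hl.2]
  have h0 := congrFun hM m
  rw [siteAct_apply, Finset.sum_eq_single c] at h0
  · have : (c : ℕ) + (k - c) = k := by omega
    rw [excitationState, hsum, if_pos this] at h0
    simpa [m] using h0
  · intro e _ he
    have : ¬ (e : ℕ) + (k - c) = k := fun h => he (by ext; omega)
    simp [excitationState, hsum, this]
  · simp

theorem SiteNondegenerate.ne_zero {d : ℕ} [NeZero n] [NeZero d] {ψ : State n d}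
    (h : SiteNondegenerate ψ) : ψ ≠ 0 := by
  rintro rfl
  exact one_ne_zero (h 0 1 (siteAct_zero_state 0 1))

/-- The amplitudes of `|E_k⟩` are the values of the top-coefficient form on monomials. The transpose
appears because `S j` acts on amplitudes, so its rows expand the images of basis vectors. -/
theorem coord_last_prod_of_localAct {A : Type*} [CommRing A] [Algebra ℂ A] {t : A}
    {b : Module.Basis (Fin (k + 1)) ℂ A} (hb : ∀ m, b m = t ^ (m : ℕ)) (ht : t ^ (k + 1) = 0)
    {S : Fin n → Matrix (Fin (k + 1)) (Fin (k + 1)) ℂ} {c : ℂ}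
    (hS : localAct S (excitationState n k) = c • excitationState n k) (x : Fin n → A) :
    b.coord (Fin.last k) (∏ j, Matrix.toLin b b (S j).transpose (x j)) =
      c * b.coord (Fin.last k) (∏ j, x j) := by
  let f : MultilinearMap ℂ (fun _ : Fin n => A) ℂ :=
    (b.coord (Fin.last k)).compMultilinearMap (MultilinearMap.mkPiAlgebra ℂ (Fin n) A)
  suffices f.compLinearMap (fun j => Matrix.toLin b b (S j).transpose) = c • f from
    congrArg (fun g => g x) this
  refine Module.Basis.ext_multilinear (fun _ => b) fun m => ?_
  have hE : ∀ i : Fin n → Fin (k + 1),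
      b.coord (Fin.last k) (∏ j, b (i j)) = excitationState n k i := by
    intro i
    simp only [hb, Finset.prod_pow_eq_pow_sum, b.coord_apply, repr_pow_of_powers hb ht,
      excitationState, Fin.val_last]
  have h0 := congrFun hS m
  simp only [f, MultilinearMap.compLinearMap_apply, LinearMap.compMultilinearMap_apply,
    MultilinearMap.mkPiAlgebra_apply, smul_apply, hE, Matrix.toLin_self,
    Matrix.transpose_apply]
  rw [← Pi.smul_apply, ← h0, localAct, Finset.prod_univ_sum, Fintype.piFinset_univ, map_sum]
  refine Finset.sum_congr rfl fun i _ => ?_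
  rw [Finset.prod_smul, map_smul, hE, smul_eq_mul]

end Excitation

/-! ### Shears, triangular unitaries and conjugated diagonal matrices. -/

section Shear

variable {k : ℕ}

theorem shear_mul_apply (a : ℂ) (M : Matrix (Fin (k + 1)) (Fin (k + 1)) ℂ)
    (r c : Fin (k + 1)) :
    (shear k a * M) r c = M r c + if (r : ℕ) + 1 = k then a * M (Fin.last k) c else 0 := by
  have : ∀ x : Fin (k + 1), shear k a r x * M x c =
      (if r = x then M x c else 0) +
        if x = Fin.last k then (if (r : ℕ) + 1 = k then a * M x c else 0) else 0 := by
    intro x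
    by_cases hx : x = Fin.last k
    · subst hx
      by_cases hr : (r : ℕ) + 1 = k
      · have : r ≠ Fin.last k := by rintro rfl; simp at hr
        simp [shear, hr, this]
      · simp [shear, hr]
    · have : ¬ (x : ℕ) = k := fun h => hx (by ext; simpa using h)
      simp [shear, hx, this]
  rw [Matrix.mul_apply, Finset.sum_congr rfl fun x _ => this x, Finset.sum_add_distrib]
  simp

theorem shear_mul_shear (a a' : ℂ) : shear k a * shear k a' = shear k (a + a') := by
  ext r c
  rw [shear_mul_apply]
  by_cases hr : (r : ℕ) + 1 = k
  · have h1 : r ≠ Fin.last k := by rintro rfl; simp at hr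
    by_cases hc : c = Fin.last k
    · subst hc
      simp [shear, hr, h1, add_comm]
    · have : ¬ (c : ℕ) = k := fun h => hc (by ext; simpa using h)
      simp [shear, hr, this, Ne.symm hc]
  · simp [shear, hr]

theorem shear_zero : shear k 0 = 1 := by
  ext r c
  simp [shear, Matrix.one_apply]

theorem shear_neg_mul_shear (a : ℂ) : shear k (-a) * shear k a = 1 := by
  rw [shear_mul_shear, neg_add_cancel, shear_zero]

theorem shear_mul_shear_neg (a : ℂ) : shear k a * shear k (-a) = 1 := by
  rw [shear_mul_shear, add_neg_cancel, shear_zero]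

theorem isUpperTriangular_shear (a : ℂ) : (shear k a).IsUpperTriangular := by
  intro r c (h : c < r)
  simp only [shear]
  rw [if_neg h.ne', if_neg]
  rintro ⟨h1, h2⟩
  have : (c : ℕ) < r := h
  omega

/-- The inverse is again upper triangular, but it equals the adjoint, which is lower triangular. -/
theorem apply_eq_zero_of_isUpperTriangular_of_mem_unitaryGroup {d : ℕ}
    {B : Matrix (Fin d) (Fin d) ℂ} (hB : B.IsUpperTriangular)
    (hU : B ∈ Matrix.unitaryGroup (Fin d) ℂ) {r c : Fin d} (h : r ≠ c) : B r c = 0 := by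
  rcases lt_or_gt_of_ne h with h | h
  · have h1 : B * star B = 1 := Matrix.mem_unitaryGroup_iff.1 hU
    let _ : Invertible B := ⟨star B, Matrix.mem_unitaryGroup_iff'.1 hU, h1⟩
    have h2 := Matrix.blockTriangular_inv_of_blockTriangular hB
    rw [Matrix.inv_eq_right_inv h1] at h2
    have h3 : star (B r c) = 0 := h2 h
    exact star_eq_zero.1 h3
  · exact hB h

theorem apply_of_shear_conj (a : ℂ) {B : Matrix (Fin (k + 1)) (Fin (k + 1)) ℂ}
    (hB : ∀ r c, r ≠ c → B r c = 0) (r c : Fin (k + 1)) :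
    (shear k (-a) * B * shear k a) r c = (if c = r then B r r else 0) +
      if c = Fin.last k then
        if (r : ℕ) + 1 = k then a * (B r r - B (Fin.last k) (Fin.last k)) else 0
      else 0 := by
  have hBs : ∀ r c, (B * shear k a) r c = B r r * shear k a r c := by
    intro r c
    rw [Matrix.mul_apply, Finset.sum_eq_single r]
    · intro x _ hx
      rw [hB r x hx.symm, zero_mul]
    · simp
  rw [mul_assoc, shear_mul_apply, hBs, hBs]
  by_cases hr : (r : ℕ) + 1 = k
  · have h1 : r ≠ Fin.last k := by rintro rfl; simp at hr
    by_cases hc : c = Fin.last k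
    · subst hc
      simp [shear, hr, h1, h1.symm]
      ring
    · have : ¬ (c : ℕ) = k := fun h => hc (by ext; simpa using h)
      simp [shear, hr, this, hc, Ne.symm hc, eq_comm (a := r)]
  · simp [shear, hr, eq_comm (a := r)]

end Shear

/-! ### Stabilizers of the sheared excitation state. -/

section ShearedExcitation

variable {n k : ℕ}

theorem toLin_eq_smul_of_stabilizer_pair {A : Type*} [CommRing A] [Algebra ℂ A] {t : A}
    {b : Module.Basis (Fin (k + 1)) ℂ A} (hb : ∀ m, b m = t ^ (m : ℕ)) (ht : t ^ (k + 1) = 0)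
    (hk : 2 ≤ k) {a : Fin n → ℂ} {B : Fin n → Matrix (Fin (k + 1)) (Fin (k + 1)) ℂ} {c : ℂ}
    (hc : c ≠ 0)
    (hS : localAct (fun j => shear k (-a j) * B j * shear k (a j)) (excitationState n k) =
      c • excitationState n k) {i p q : Fin n} (hpi : p ≠ i) (hqi : q ≠ i) (hpq : p ≠ q)
    (hp : B p ∈ Matrix.unitaryGroup (Fin (k + 1)) ℂ)
    (hq : B q ∈ Matrix.unitaryGroup (Fin (k + 1)) ℂ) (ha : a p ≠ a q ∨ 3 ≤ k ∧ a p ≠ 0) :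
    ∃ s : ℂ, s ≠ 0 ∧
      ∀ x, Matrix.toLin b b (shear k (-a p) * B p * shear k (a p)).transpose x = s • x := by
  have : FiniteDimensional ℂ A := Module.Finite.of_basis b
  set S := fun j => shear k (-a j) * B j * shear k (a j) with hSdef
  let F : Fin n → A →ₗ[ℂ] A := fun j => Matrix.toLin b b (S j).transpose
  have hF : ∀ j m, F j (b m) = ∑ l, S j m l • b l := fun j m => Matrix.toLin_self b b _ m
  have hprod : ∀ f : Fin n → A, ∏ j, f j =
      (∏ j ∈ ((Finset.univ.erase i).erase p).erase q, f j) * f i * f p * f q := by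
    intro f
    rw [← Finset.mul_prod_erase _ _ (Finset.mem_univ i),
      ← Finset.mul_prod_erase _ _ (Finset.mem_erase.2 ⟨hpi, Finset.mem_univ p⟩),
      ← Finset.mul_prod_erase _ _
        (Finset.mem_erase.2 ⟨hpq.symm, Finset.mem_erase.2 ⟨hqi, Finset.mem_univ q⟩⟩)]
    ring
  -- Putting `1` at all sites other than `i`, `p`, `q` leaves a trilinear form; the resulting
  -- constant is absorbed into the operator at `i`.
  let w : A := ∏ j ∈ ((Finset.univ.erase i).erase p).erase q, F j 1
  have htri : ∀ x y z, b.coord (Fin.last k) ((LinearMap.mulLeft ℂ w ∘ₗ F i) x * F p y * F q z) =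
      c * b.coord (Fin.last k) (x * y * z) := by
    intro x y z
    let v : Fin n → A := Function.update (Function.update (Function.update 1 q z) p y) i x
    have hvi : v i = x := by simp [v]
    have hvp : v p = y := by simp [v, hpi]
    have hvq : v q = z := by simp [v, hqi, hpq.symm]
    have hv : ∀ j ∈ ((Finset.univ.erase i).erase p).erase q, v j = 1 := by
      intro j hj
      simp only [Finset.mem_erase, Finset.mem_univ, and_true] at hj
      simp [v, hj.1, hj.2.1, hj.2.2]
    have h1 := coord_last_prod_of_localAct hb ht hS v
    rw [hprod, hprod, hvi, hvp, hvq, Finset.prod_congr rfl hv,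
      Finset.prod_congr rfl fun j hj => by rw [hv j hj]] at h1
    simpa [w, F] using h1
  obtain ⟨φ, hφ, hP, hQ⟩ := exists_algHom_of_trilinear_invariant _
    (eq_zero_of_coord_last_mul hb ht) _ _ _ hc htri
  have hdiag : ∀ j, B j ∈ Matrix.unitaryGroup (Fin (k + 1)) ℂ → (∀ y, F j y = F j 1 * φ y) →
      ∀ r c, r ≠ c → B j r c = 0 := by
    intro j hj hφj r c
    refine apply_eq_zero_of_isUpperTriangular_of_mem_unitaryGroup ?_ hj
    have hSj : (S j).IsUpperTriangular := by
      intro r c (hrc : c < r)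
      have h1 := repr_algHom_pow_eq_zero_of_lt hb ht φ (F j 1) (N := r) (l := c) hrc
      rw [← hφj, ← hb, hF] at h1
      simpa [Finsupp.single_apply] using h1
    have h2 : B j = shear k (a j) * S j * shear k (-a j) := by
      simp only [hSdef, ← mul_assoc, shear_mul_shear_neg, one_mul]
      rw [mul_assoc, shear_mul_shear_neg, mul_one]
    rw [h2]
    exact ((isUpperTriangular_shear _).mul hSj).mul (isUpperTriangular_shear _)
  have hval : ∀ j, (∀ r c, r ≠ c → B j r c = 0) → ∀ m : Fin (k + 1), F j (t ^ (m : ℕ)) =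
      B j m m • t ^ (m : ℕ) + if (m : ℕ) + 1 = k then
        (a j * (B j m m - B j (Fin.last k) (Fin.last k))) • t ^ k else 0 := by
    intro j hj m
    rw [← hb, hF]
    simp only [hSdef, apply_of_shear_conj (a j) hj, add_smul, Finset.sum_add_distrib, ite_smul,
      zero_smul, Finset.sum_ite_eq', Finset.mem_univ, if_true]
    rw [hb (Fin.last k), Fin.val_last]
  have hone : ∀ j, (∀ r c, r ≠ c → B j r c = 0) → F j 1 = B j 0 0 • (1 : A) := by
    intro j hj
    have h1 := hval j hj 0
    rw [if_neg (by simp; omega)] at h1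
    simpa using h1
  have hne : ∀ j, B j ∈ Matrix.unitaryGroup (Fin (k + 1)) ℂ → (∀ r c, r ≠ c → B j r c = 0) →
      B j 0 0 ≠ 0 := by
    intro j hj hd h0
    have h1 := congrFun (congrFun (Matrix.mem_unitaryGroup_iff.1 hj) 0) 0
    rw [Matrix.mul_apply, Finset.sum_eq_zero] at h1
    · simp at h1
    · intro x _
      by_cases hx : x = 0
      · subst hx; rw [h0, zero_mul]
      · rw [hd 0 x (Ne.symm hx), zero_mul]
  -- Dividing by `F j 1 = B j 0 0` turns the formula for `F j` into one for `φ`. The reduction in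
  -- `Fin.ofNat` is harmless for `m ≤ k`.
  have hφval : ∀ j, B j ∈ Matrix.unitaryGroup (Fin (k + 1)) ℂ → (∀ y, F j y = F j 1 * φ y) →
      ∀ m ≤ k, φ (t ^ m) = (B j (Fin.ofNat (k + 1) m) (Fin.ofNat (k + 1) m) / B j 0 0) • t ^ m +
        if m + 1 = k then (a j * (B j (Fin.ofNat (k + 1) m) (Fin.ofNat (k + 1) m) / B j 0 0 -
          B j (Fin.ofNat (k + 1) k) (Fin.ofNat (k + 1) k) / B j 0 0)) • t ^ k else 0 := by
    intro j hj hφj m hm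
    have hd := hdiag j hj hφj
    have h0 := hne j hj hd
    have h1 := hφj (t ^ m)
    have hm' : ((Fin.ofNat (k + 1) m : Fin (k + 1)) : ℕ) = m := Nat.mod_eq_of_lt (by omega)
    have hl : Fin.ofNat (k + 1) k = Fin.last k := Fin.ext (Nat.mod_eq_of_lt (by omega))
    have h2 := hval j hd (Fin.ofNat (k + 1) m)
    rw [hm'] at h2
    rw [h2, hone j hd, smul_mul_assoc, one_mul] at h1
    rw [hl, ← inv_smul_smul₀ h0 (φ (t ^ m)), ← h1, smul_add, smul_smul, inv_mul_eq_div, smul_ite,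
      smul_smul, smul_zero]
    congr 3
    ring
  have hφt : φ t = t := algHom_fixes_generator hb ht hk φ hφ ha (hφval p hp hP) (hφval q hq hQ)
  have hφid : ∀ x, φ x = x := by
    intro x
    have : φ.toLinearMap = LinearMap.id := b.ext fun m => by simp [hb, hφt]
    exact congrArg (fun g => g x) this
  have hd := hdiag p hp hP
  refine ⟨B p 0 0, hne p hp hd, fun x => ?_⟩
  have h1 := hP x
  rw [hφid, hone p hd, smul_mul_assoc, one_mul] at h1
  exact h1

/-- Each site `p ≠ i` is paired with a third site `q`, so all factors away from `i` are scalar after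
unshearing. Nondegeneracy of the form then determines the factor at `i` as a scalar too. -/
theorem scalarStabilizerAt_shear_excitationState (hn : 3 ≤ n) (hk : 2 ≤ k) {a : Fin n → ℂ}
    (ha : ∀ p q, p ≠ q → a p ≠ a q ∨ 3 ≤ k ∧ a p ≠ 0) (i : Fin n) :
    ScalarStabilizerAt i (localAct (fun j => shear k (a j)) (excitationState n k)) := by
  intro B hB c hc hBc
  obtain ⟨A, _, _, t, b, hb, ht⟩ := exists_truncated_polynomial_basis k
  have hS : localAct (fun j => shear k (-a j) * B j * shear k (a j)) (excitationState n k) =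
      c • excitationState n k := by
    have h1 := congrArg (localAct fun j => shear k (-a j)) hBc
    rw [localAct_smul, localAct_localAct, localAct_localAct, localAct_localAct] at h1
    have h2 : (fun j => shear k (-a j)) * (fun j => shear k (a j)) = 1 :=
      funext fun j => shear_neg_mul_shear (a j)
    rw [h2, localAct_one] at h1
    rw [← h1]
    congr 1
  have hsc : ∀ p, p ≠ i → ∃ s : ℂ, s ≠ 0 ∧
      ∀ x, Matrix.toLin b b (shear k (-a p) * B p * shear k (a p)).transpose x = s • x := by
    intro p hp
    obtain ⟨q, hq⟩ : ∃ q, q ∉ ({i, p} : Finset (Fin n)) := by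
      by_contra! h
      have h1 := Finset.card_le_two (a := i) (b := p)
      rw [Finset.eq_univ_of_forall h, Finset.card_univ, Fintype.card_fin] at h1
      omega
    simp only [Finset.mem_insert, Finset.mem_singleton, not_or] at hq
    exact toLin_eq_smul_of_stabilizer_pair hb ht hk hc hS hp hq.1 (Ne.symm hq.2) (hB p hp)
      (hB q hq.1) (ha p q (Ne.symm hq.2))
  choose! s hs0 hs using hsc
  set S := fun j => shear k (-a j) * B j * shear k (a j) with hSdef
  have : Nontrivial (Fin n) := Fin.nontrivial_iff_two_le.2 (by omega)
  obtain ⟨p, hp⟩ := exists_ne i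
  set D : ℂ := ∏ j ∈ Finset.univ.erase i, s j
  have hD : D ≠ 0 := Finset.prod_ne_zero_iff.2 fun j hj => hs0 j (Finset.ne_of_mem_erase hj)
  have hTi : ∀ x, Matrix.toLin b b (S i).transpose x = (c / D) • x := by
    intro x
    refine sub_eq_zero.1 (eq_zero_of_coord_last_mul hb ht _ fun y => ?_)
    let v : Fin n → A := Function.update (Function.update 1 p y) i x
    have hv : ∏ j ∈ Finset.univ.erase i, v j = y := by
      rw [← Finset.mul_prod_erase _ _ (Finset.mem_erase.2 ⟨hp, Finset.mem_univ p⟩),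
        Finset.prod_eq_one]
      · simp [v, hp]
      · intro j hj
        simp only [Finset.mem_erase, Finset.mem_univ, and_true] at hj
        simp [v, hj.1, hj.2]
    have h1 := coord_last_prod_of_localAct hb ht hS v
    rw [← Finset.mul_prod_erase _ _ (Finset.mem_univ i),
      ← Finset.mul_prod_erase _ v (Finset.mem_univ i), hv,
      Finset.prod_congr rfl fun j hj => hs j (Finset.ne_of_mem_erase hj) (v j),
      Finset.prod_smul, hv, mul_smul_comm, map_smul, smul_eq_mul] at h1
    have hvi : v i = x := by simp [v]
    rw [hvi] at h1
    rw [sub_mul, map_sub, smul_mul_assoc, map_smul, smul_eq_mul, sub_eq_zero, div_mul_eq_mul_div,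
      eq_div_iff hD, ← h1, mul_comm]
  have hSi : (S i).transpose = (c / D) • 1 := by
    apply (Matrix.toLin b b).injective
    ext x
    rw [hTi, map_smul, Matrix.toLin_one]
    rfl
  have hSi' : S i = (c / D) • 1 := by
    rw [← Matrix.transpose_transpose (S i), hSi, Matrix.transpose_smul, Matrix.transpose_one]
  refine ⟨c / D, ?_⟩
  have h2 : B i = shear k (a i) * S i * shear k (-a i) := by
    simp only [hSdef, ← mul_assoc, shear_mul_shear_neg, one_mul]
    rw [mul_assoc, shear_mul_shear_neg, mul_one]
  rw [h2, hSi', Matrix.mul_smul, mul_one, Matrix.smul_mul, shear_mul_shear_neg]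

/-- `shear k a` as an element of the general linear group. -/
noncomputable def shearGL (a : ℂ) : Matrix.GeneralLinearGroup (Fin (k + 1)) ℂ :=
  ⟨shear k a, shear k (-a), shear_mul_shear_neg a, shear_neg_mul_shear a⟩

theorem weaklyIsolated_shear_excitationState (hn : 3 ≤ n) (hk : 2 ≤ k) {a : Fin n → ℂ}
    (ha : ∀ p q, p ≠ q → a p ≠ a q ∨ 3 ≤ k ∧ a p ≠ 0) :
    WeaklyIsolated (localAct (fun j => shear k (a j)) (excitationState n k)) := by
  have hnd : SiteNondegenerate (localAct (fun j => shear k (a j)) (excitationState n k)) :=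
    (siteNondegenerate_excitationState (by omega)).localAct
      (Pi.isUnit_iff.2 fun j => (shearGL (a j)).isUnit)
  have : NeZero n := ⟨by omega⟩
  exact weaklyIsolated_of_scalarStabilizerAt hnd.ne_zero hnd
    (scalarStabilizerAt_shear_excitationState hn hk ha)

theorem SLOCCEquiv_shear_excitationState (a : Fin n → ℂ) :
    SLOCCEquiv (localAct (fun j => shear k (a j)) (excitationState n k)) (excitationState n k) :=
  ⟨fun j => shearGL (a j), rfl⟩

theorem isSymmetric_localAct_const {d : ℕ} (M : Matrix (Fin d) (Fin d) ℂ) {ψ : State n d}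
    (hψ : IsSymmetric ψ) : IsSymmetric (localAct (fun _ => M) ψ) := by
  intro σ m
  simp only [localAct]
  refine (Fintype.sum_equiv (Equiv.arrowCongr σ.symm (Equiv.refl (Fin d))) _ _ fun i => ?_).symm
  have h1 : Equiv.arrowCongr σ.symm (Equiv.refl (Fin d)) i = i ∘ σ := by
    funext j; simp [Equiv.arrowCongr]
  rw [h1, hψ]
  congr 1
  exact (Equiv.prod_comp σ fun j => M (m j) (i j)).symm

theorem isSymmetric_excitationState : IsSymmetric (excitationState n k) := by
  intro σ m
  simp only [excitationState, Function.comp_apply, Equiv.sum_comp σ fun j => (m j : ℕ)]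

end ShearedExcitation

end LOCC

theorem theorem9 (n k : ℕ) (hn : 3 ≤ n) (hk : 2 ≤ k) :
    (∃ ψ : LOCC.State n (k + 1),
      LOCC.SLOCCEquiv ψ (LOCC.excitationState n k) ∧ LOCC.WeaklyIsolated ψ) ∧
    (∀ a : Fin n → ℂ, Function.Injective a → (∀ j, a j ≠ 0) →
      LOCC.WeaklyIsolated
        (LOCC.localAct (fun j => LOCC.shear k (a j)) (LOCC.excitationState n k))) ∧
    (3 ≤ k → ∃ ψ : LOCC.State n (k + 1),
      LOCC.SLOCCEquiv ψ (LOCC.excitationState n k) ∧ LOCC.IsSymmetric ψ ∧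
        LOCC.WeaklyIsolated ψ) := by
  have hinj : ∀ a : Fin n → ℂ, Function.Injective a → LOCC.WeaklyIsolated
      (LOCC.localAct (fun j => LOCC.shear k (a j)) (LOCC.excitationState n k)) := fun a ha =>
    LOCC.weaklyIsolated_shear_excitationState hn hk fun p q hpq => Or.inl (ha.ne hpq)
  -- The party numbers serve as distinct shear parameters; for `k ≥ 3` the same shear `1` at every
  -- site keeps the state symmetric.
  refine ⟨⟨_, LOCC.SLOCCEquiv_shear_excitationState fun j => ((j : ℕ) : ℂ),
    hinj _ fun p q h => Fin.ext (Nat.cast_injective h)⟩, fun a ha _ => hinj a ha, fun hk3 =>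
    ⟨_, LOCC.SLOCCEquiv_shear_excitationState fun _ => 1,
      LOCC.isSymmetric_localAct_const _ LOCC.isSymmetric_excitationState,
      LOCC.weaklyIsolated_shear_excitationState hn hk fun _ _ _ => Or.inr ⟨hk3, one_ne_zero⟩⟩⟩
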